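/- Let $Q_0=[0,1]$ carry Lebesgue measure, and let $\mathcal D(Q_0)$ be the collection of its dyadic subintervals $[j2^{-k},(j+1)2^{-k})$, $k\ge 0$, $0\le j<2^k$; for $K\in\mathcal D(Q_0)$ put $\mathcal D(K)=\{Q\in\mathcal D(Q_0):Q\subseteq K\}$. Write $\langle\cdot\rangle_Q=\frac1{|Q|}\int_Q\cdot\,dx$ for the (entrywise) average over $Q$ of a vector- or matrix-valued function. A $d\times d$ matrix weight is an entrywise integrable function $W:Q_0\to\mathbb C^{d\times d}$ with $W(x)$ positive semidefinite for almost every $x$. For every dimension $d$ and every $A\ge 0$ there is a finite constant $B=B(A)$ (depending only on $A$ and on $d$) with the following property. Let $(\alpha_Q)_{Q\in\mathcal D(Q_0)}$ be non-negative scalars with $$\frac1{|K|}\sum_{Q\in\mathcal D(K)}\alpha_Q\le A\qquad\text{for all }K\in\mathcal D(Q_0),$$ and let $W$ be a $d\times d$ matrix weight such that $W(x)$ is invertible for almost every $x$ and $W^{-1}$ is also entrywise integrable on $Q_0$. Then for all $f,g\in L^2(Q_0;\mathbb C^d)$ $$\sum_{Q\in\mathcal D(Q_0)}\alpha_Q\Big|\Big\langle\langle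 W\rangle_Q^{-1}\langle W^{1/2}f\rangle_Q,\ \langle W^{-1}\rangle_Q^{-1}\langle W^{-1/2}g\rangle_Q\Big\rangle_{\mathbb C^d}\Big|\le B\,\|f\|_{L^2(\mathbb C^d)}\|g\|_{L^2(\mathbb C^d)}.$$ -/

import Mathlib

open MeasureTheory
open scoped ENNReal NNReal MatrixOrder ComplexOrder

noncomputable section

/-- A dyadic subinterval of the unit interval `Q₀`: generation `level` and position
`pos ∈ {0, …, 2 ^ level - 1}`. -/
structure DyadicInterval where
  /-- The generation `k`; the interval has length `2⁻ᵏ`. -/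
  level : ℕ
  /-- The position of the interval among the `2 ^ k` intervals of its generation. -/
  pos : Fin (2 ^ level)

namespace DyadicInterval

/-- The half-open interval `[j 2⁻ᵏ, (j + 1) 2⁻ᵏ)`. -/
def toSet (Q : DyadicInterval) : Set ℝ :=
  Set.Ico ((Q.pos : ℝ) / 2 ^ Q.level) (((Q.pos : ℝ) + 1) / 2 ^ Q.level)

end DyadicInterval

/-- Lebesgue measure on `Q₀ = [0, 1]`. -/
def unitVolume : Measure ℝ := volume.restrict (Set.Icc 0 1)

/-- A `d × d` matrix weight on `Q₀`: entrywise integrable and almost everywhere positive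
semidefinite. -/
structure IsMatrixWeight {d : ℕ} (W : ℝ → Matrix (Fin d) (Fin d) ℂ) : Prop where
  integrable : ∀ i j, Integrable (fun x => W x i j) unitVolume
  posSemidef : ∀ᵐ x ∂unitVolume, (W x).PosSemidef

/-- The entrywise average `⟨W⟩_Q` of a matrix function. -/
def matrixAverage {d : ℕ} (W : ℝ → Matrix (Fin d) (Fin d) ℂ) (Q : DyadicInterval) :
    Matrix (Fin d) (Fin d) ℂ :=
  Matrix.of fun i j => ⨍ x in Q.toSet, W x i j

/-- The average `⟨f⟩_Q` of a vector function. -/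
def vectorAverage {d : ℕ} (f : ℝ → EuclideanSpace ℂ (Fin d)) (Q : DyadicInterval) :
    EuclideanSpace ℂ (Fin d) :=
  ⨍ x in Q.toSet, f x

/-- The vector `⟨W⟩_Q⁻¹ ⟨W^{1/2} f⟩_Q`. For the weight `W⁻¹` this is
`⟨W⁻¹⟩_Q⁻¹ ⟨W^{-1/2} f⟩_Q`, since `W^{-1/2} = (W⁻¹)^{1/2}` for positive definite `W`. -/
def weightedAverage {d : ℕ} (W : ℝ → Matrix (Fin d) (Fin d) ℂ)
    (f : ℝ → EuclideanSpace ℂ (Fin d)) (Q : DyadicInterval) : EuclideanSpace ℂ (Fin d) :=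
  Matrix.toEuclideanLin (matrixAverage W Q)⁻¹
    (vectorAverage (fun x => Matrix.toEuclideanLin (CFC.sqrt (W x)) (f x)) Q)

/-- `(1 / |K|) ∑_{Q ⊆ K} α_Q ≤ A` for every dyadic interval `K`. -/
def IsCarlesonSequence (α : DyadicInterval → ℝ≥0) (A : ℝ≥0) : Prop :=
  ∀ K : DyadicInterval,
    (volume K.toSet)⁻¹ * ∑' Q : {Q : DyadicInterval // Q.toSet ⊆ K.toSet}, (α Q : ℝ≥0∞) ≤ A

end

/-! Let `Z_Q = (∫_Q W, ∫_Q W⁻¹, |Q|)`. It lies in the cone of triples `(X, Y, c)` for which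
`2 c |⟨v, w⟩| ≤ ⟨X v, v⟩ + ⟨Y w, w⟩` for all `v`, `w`, and `Z_Q` is additive in `Q`. Visiting the
intervals from the smallest to the largest, let each `Q` remove from what is left of `A • Z_Q` the
multiple `(D_Q, D'_Q, α_Q)` with third entry `α_Q`; the Carleson condition says that enough is
always left. The removed parts lie in the cone and satisfy `∑_{P ⊆ K} D_P ≤ A ∫_K W` and
`∑_{P ⊆ K} D'_P ≤ A ∫_K W⁻¹`. The bilinear sum is therefore bounded by two one-weight sums
`∑ ⟨D_Q V_Q⁻¹ F_Q, V_Q⁻¹ F_Q⟩`, where `V_Q = ∫_Q W` and `F_Q = ∫_Q W^{1/2} f` in the first, and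
similarly in the second.

Such a sum is bounded with the Bellman function `∑_{s = 1}^{d + 1} ⟨(V + s M)⁻¹ F, F⟩`, where
`M = ∑_{P ⊆ Q} D_P ≤ A V`. At each `Q` it gains `⟨D u_s, u_s⟩` with `u_s = (V + s M)⁻¹ F`, whereas
the sum asks for `u_0`. The adjugate of `V + s M` is a polynomial in `s` of degree at most `d`, so
its value at `s = 0` is extrapolated from those at `1, …, d + 1`, and the determinants of `V + s M`
and `V` are comparable because `M ≤ A V`.
-/

namespace MatrixCarleson

open Matrix

section QuadForm

variable {𝕜 n : Type*} [RCLike 𝕜] [Fintype n]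

/-- The quadratic form `v ↦ Re ⟨X v, v⟩` of a matrix. For Hermitian `X` the real part is
redundant. -/
def quadForm (X : Matrix n n 𝕜) (v : n → 𝕜) : ℝ := RCLike.re (star v ⬝ᵥ X *ᵥ v)

theorem quadForm_add (X Y : Matrix n n 𝕜) (v : n → 𝕜) :
    quadForm (X + Y) v = quadForm X v + quadForm Y v := by
  simp [quadForm, add_mulVec, dotProduct_add]

theorem quadForm_sub (X Y : Matrix n n 𝕜) (v : n → 𝕜) :
    quadForm (X - Y) v = quadForm X v - quadForm Y v := by
  simp [quadForm, sub_mulVec, dotProduct_sub]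

theorem quadForm_smul (c : ℝ) (X : Matrix n n 𝕜) (v : n → 𝕜) :
    quadForm (c • X) v = c * quadForm X v := by
  simp [quadForm, smul_mulVec, dotProduct_smul, RCLike.smul_re]

theorem quadForm_smul_vec (c : 𝕜) (X : Matrix n n 𝕜) (v : n → 𝕜) :
    quadForm X (c • v) = ‖c‖ ^ 2 * quadForm X v := by
  rw [quadForm, quadForm, mulVec_smul, star_smul, smul_dotProduct, dotProduct_smul, smul_smul,
    RCLike.star_def, RCLike.conj_mul, smul_eq_mul, ← RCLike.ofReal_pow, RCLike.re_ofReal_mul]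

theorem quadForm_nonneg {X : Matrix n n 𝕜} (hX : 0 ≤ X) (v : n → 𝕜) : 0 ≤ quadForm X v :=
  (nonneg_iff_posSemidef.1 hX).re_dotProduct_nonneg v

theorem quadForm_mono {X Y : Matrix n n 𝕜} (h : X ≤ Y) (v : n → 𝕜) :
    quadForm X v ≤ quadForm Y v := by
  rw [← sub_nonneg, ← quadForm_sub]
  exact quadForm_nonneg (sub_nonneg.2 h) v

theorem quadForm_sub_vec {X : Matrix n n 𝕜} (hX : X.IsHermitian) (v w : n → 𝕜) :
    quadForm X (v - w) =
      quadForm X v + quadForm X w - 2 * RCLike.re (star w ⬝ᵥ X *ᵥ v) := by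
  have h : RCLike.re (star v ⬝ᵥ X *ᵥ w) = RCLike.re (star w ⬝ᵥ X *ᵥ v) := by
    rw [star_dotProduct, star_mulVec, hX.eq, ← dotProduct_mulVec, RCLike.star_def, RCLike.conj_re]
  simp only [quadForm, star_sub, mulVec_sub, sub_dotProduct, dotProduct_sub, map_sub, h]
  ring

theorem quadForm_one [DecidableEq n] (v : n → 𝕜) : quadForm 1 v = ‖WithLp.toLp 2 v‖ ^ 2 := by
  rw [← inner_self_eq_norm_sq (𝕜 := 𝕜), EuclideanSpace.inner_eq_star_dotProduct, quadForm,
    one_mulVec, dotProduct_comm]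

theorem star_dotProduct_sqrt_mulVec [DecidableEq n] (X : Matrix n n 𝕜) (v w : n → 𝕜) :
    star w ⬝ᵥ CFC.sqrt X *ᵥ v = star (CFC.sqrt X *ᵥ w) ⬝ᵥ v := by
  have hS : (CFC.sqrt X).PosSemidef := nonneg_iff_posSemidef.1 (CFC.sqrt_nonneg X)
  rw [star_mulVec, hS.isHermitian.eq, ← dotProduct_mulVec]

theorem quadForm_eq_norm_sqrt_mulVec_sq [DecidableEq n] {X : Matrix n n 𝕜} (hX : 0 ≤ X)
    (v : n → 𝕜) :
    quadForm X v = ‖WithLp.toLp 2 (CFC.sqrt X *ᵥ v)‖ ^ 2 := by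
  rw [← quadForm_one, quadForm, quadForm, one_mulVec, ← star_dotProduct_sqrt_mulVec, mulVec_mulVec,
    CFC.sqrt_mul_sqrt_self X hX]

theorem quadForm_sum_smul_le {X : Matrix n n 𝕜} (hX : 0 ≤ X) {ι : Type*} (s : Finset ι)
    (c : ι → 𝕜) (v : ι → n → 𝕜) :
    quadForm X (∑ i ∈ s, c i • v i) ≤ (∑ i ∈ s, ‖c i‖ ^ 2) * ∑ i ∈ s, quadForm X (v i) := by
  classical
  simp only [quadForm_eq_norm_sqrt_mulVec_sq hX, mulVec_sum, mulVec_smul, WithLp.toLp_sum,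
    WithLp.toLp_smul]
  calc ‖∑ i ∈ s, c i • WithLp.toLp 2 (CFC.sqrt X *ᵥ v i)‖ ^ 2
      ≤ (∑ i ∈ s, ‖c i‖ * ‖WithLp.toLp 2 (CFC.sqrt X *ᵥ v i)‖) ^ 2 := by
        gcongr
        exact norm_sum_le_of_le s fun i _ => norm_smul_le _ _
    _ ≤ _ := Finset.sum_mul_sq_le_sq_mul_sq _ _ _

variable [DecidableEq n]

theorem two_re_dotProduct_sqrt_mulVec_le {X : Matrix n n 𝕜} (hX : 0 ≤ X) (v w : n → 𝕜) :
    2 * RCLike.re (star w ⬝ᵥ CFC.sqrt X *ᵥ v) ≤ quadForm X w + ‖WithLp.toLp 2 v‖ ^ 2 := by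
  have h := quadForm_nonneg (zero_le_one (α := Matrix n n 𝕜)) (v - CFC.sqrt X *ᵥ w)
  rw [quadForm_sub_vec isHermitian_one, quadForm_one, quadForm_one,
    ← quadForm_eq_norm_sqrt_mulVec_sq hX, one_mulVec, ← star_dotProduct_sqrt_mulVec] at h
  linarith

/-! ### The quadratic form of the inverse -/

theorem mulVec_inv_mulVec {X : Matrix n n 𝕜} (hX : X.PosDef) (v : n → 𝕜) :
    X *ᵥ (X⁻¹ *ᵥ v) = v := by
  rw [mulVec_mulVec, mul_nonsing_inv _ hX.det_pos.ne'.isUnit, one_mulVec]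

/-- Together with `quadForm_inv_eq`, this is the variational formula
`⟨X⁻¹ v, v⟩ = max_w (2 Re ⟨v, w⟩ - ⟨X w, w⟩)`. -/
theorem two_re_dotProduct_sub_quadForm_le {X : Matrix n n 𝕜} (hX : X.PosDef) (v w : n → 𝕜) :
    2 * RCLike.re (star w ⬝ᵥ v) - quadForm X w ≤ quadForm X⁻¹ v := by
  have h := quadForm_nonneg hX.posSemidef.nonneg (X⁻¹ *ᵥ v - w)
  have h' : quadForm X (X⁻¹ *ᵥ v) = quadForm X⁻¹ v := by
    rw [quadForm, mulVec_inv_mulVec hX, quadForm, star_mulVec, hX.inv.isHermitian.eq,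
      dotProduct_mulVec]
  rw [quadForm_sub_vec hX.isHermitian, mulVec_inv_mulVec hX, h'] at h
  linarith

theorem quadForm_inv_eq {X : Matrix n n 𝕜} (hX : X.PosDef) (v : n → 𝕜) :
    quadForm X⁻¹ v = 2 * RCLike.re (star (X⁻¹ *ᵥ v) ⬝ᵥ v) - quadForm X (X⁻¹ *ᵥ v) := by
  have h : quadForm X⁻¹ v = RCLike.re (star (X⁻¹ *ᵥ v) ⬝ᵥ v) := by
    rw [quadForm, star_mulVec, hX.inv.isHermitian.eq, dotProduct_mulVec]
  have h' : quadForm X (X⁻¹ *ᵥ v) = RCLike.re (star (X⁻¹ *ᵥ v) ⬝ᵥ v) := by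
    rw [quadForm, mulVec_inv_mulVec hX]
  linarith

theorem two_norm_dotProduct_le {X : Matrix n n 𝕜} (hX : X.PosDef) (v w : n → 𝕜) :
    2 * ‖star v ⬝ᵥ w‖ ≤ quadForm X v + quadForm X⁻¹ w := by
  obtain ⟨c, hc, hcz⟩ := RCLike.exists_norm_eq_mul_self (star v ⬝ᵥ w)
  have h := two_re_dotProduct_sub_quadForm_le hX w (star c • v)
  rw [star_smul, star_star, smul_dotProduct, smul_eq_mul, ← hcz, RCLike.ofReal_re,
    quadForm_smul_vec, norm_star, hc] at h
  linarith

/-- Joint subadditivity of `(X, v) ↦ ⟨X⁻¹ v, v⟩`, with the gain produced by an extra summand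
`D`. -/
theorem quadForm_inv_add_add_le {X Y D : Matrix n n 𝕜} (hX : X.PosDef) (hY : Y.PosDef)
    (hD : 0 ≤ D) (v w : n → 𝕜) :
    quadForm (X + Y + D)⁻¹ (v + w) + quadForm D ((X + Y + D)⁻¹ *ᵥ (v + w)) ≤
      quadForm X⁻¹ v + quadForm Y⁻¹ w := by
  set u := (X + Y + D)⁻¹ *ᵥ (v + w) with hu
  have h := quadForm_inv_eq ((hX.add hY).add_posSemidef (nonneg_iff_posSemidef.1 hD)) (v + w)
  have hv := two_re_dotProduct_sub_quadForm_le hX v u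
  have hw := two_re_dotProduct_sub_quadForm_le hY w u
  rw [← hu, quadForm_add, quadForm_add, dotProduct_add, map_add] at h
  linarith

/-! ### Comparison of determinants -/

theorem norm_det_le_pow {X : Matrix n n 𝕜} {c : ℝ} (hX : 0 ≤ X) (hXc : X ≤ c • 1) :
    ‖X.det‖ ≤ c ^ Fintype.card n := by
  have hX' := nonneg_iff_posSemidef.1 hX
  rw [hX'.isHermitian.det_eq_prod_eigenvalues, norm_prod, ← Finset.card_univ, ← Finset.prod_const]
  refine Finset.prod_le_prod (fun _ _ => norm_nonneg _) fun i _ => ?_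
  rw [RCLike.norm_ofReal, abs_of_nonneg (hX'.eigenvalues_nonneg i)]
  calc hX'.isHermitian.eigenvalues i
      = quadForm X (hX'.isHermitian.eigenvectorBasis i) := hX'.isHermitian.eigenvalues_eq i
    _ ≤ quadForm (c • 1) (hX'.isHermitian.eigenvectorBasis i) := quadForm_mono hXc _
    _ = c := by simp [quadForm_smul, quadForm_one]

theorem norm_det_le_pow_mul {X Y : Matrix n n 𝕜} {c : ℝ} (hY : Y.PosDef) (hX : 0 ≤ X)
    (hXY : X ≤ c • Y) : ‖X.det‖ ≤ c ^ Fintype.card n * ‖Y.det‖ := by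
  set S := CFC.sqrt Y
  have hSS : S * S = Y := CFC.sqrt_mul_sqrt_self Y hY.posSemidef.nonneg
  have hS : IsUnit S.det := isUnit_of_mul_isUnit_left (y := S.det) <| by
    rw [← det_mul, hSS]
    exact hY.det_pos.ne'.isUnit
  have hSi : star S⁻¹ = S⁻¹ :=
    (nonneg_iff_posSemidef.1 (CFC.sqrt_nonneg Y)).isHermitian.inv.eq
  have hone : S⁻¹ * (c • Y) * S⁻¹ = c • 1 := by
    rw [mul_smul_comm, smul_mul_assoc, ← hSS, nonsing_inv_mul_cancel_left _ _ hS,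
      mul_nonsing_inv _ hS]
  have hle : ‖(S⁻¹ * X * S⁻¹).det‖ ≤ c ^ Fintype.card n := by
    refine norm_det_le_pow ?_ ?_
    · simpa only [hSi] using star_left_conjugate_nonneg hX S⁻¹
    · simpa only [hSi, hone] using star_left_conjugate_le_conjugate hXY S⁻¹
  have hdet : X.det = (S⁻¹ * X * S⁻¹).det * Y.det := by
    rw [← hSS, ← det_mul, ← mul_assoc, nonsing_inv_mul_cancel_right _ _ hS, det_mul, det_mul,
      mul_right_comm, ← det_mul, nonsing_inv_mul _ hS, det_one, one_mul]
  rw [hdet, norm_mul]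
  gcongr

end QuadForm

/-! ### Extrapolation of a matrix pencil -/

theorem exists_eval_zero_eq_sum (𝕜 : Type*) [Field 𝕜] [CharZero 𝕜] (N : ℕ) :
    ∃ c : ℕ → 𝕜, ∀ p : Polynomial 𝕜, p.natDegree ≤ N →
      p.eval 0 = ∑ k ∈ Finset.range (N + 1), c k * p.eval ((k + 1 : ℕ) : 𝕜) := by
  let node : ℕ → 𝕜 := fun k => (k + 1 : ℕ)
  refine ⟨fun k => (Lagrange.basis (Finset.range (N + 1)) node k).eval 0, fun p hp => ?_⟩
  have hnode : Set.InjOn node (Finset.range (N + 1)) :=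
    (Nat.cast_injective.comp (add_left_injective 1)).injOn
  have hdeg : p.degree < (Finset.range (N + 1)).card := by
    rw [Finset.card_range]
    exact (Polynomial.degree_le_of_natDegree_le hp).trans_lt (by exact_mod_cast N.lt_succ_self)
  conv_lhs => rw [Lagrange.eq_interpolate hnode hdeg, Lagrange.interpolate_apply,
    Polynomial.eval_finsetSum]
  exact Finset.sum_congr rfl fun k _ => by rw [Polynomial.eval_mul, Polynomial.eval_C, mul_comm]

theorem exists_polynomial_eval_eq_adjugate {R n : Type*} [CommRing R] [Fintype n] [DecidableEq n]
    (W M : Matrix n n R) (i j : n) :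
    ∃ p : Polynomial R, p.natDegree ≤ Fintype.card n ∧
      ∀ s, p.eval s = (W + s • M).adjugate i j := by
  refine ⟨_, Polynomial.natDegree_det_X_add_C_le (M.updateRow j 0)
    (W.updateRow j (Pi.single i 1)), fun s => ?_⟩
  rw [adjugate_apply, ← Polynomial.coe_evalRingHom, RingHom.map_det]
  congr 1
  ext a b
  obtain rfl | h := eq_or_ne a j
  · simp
  · simp [h, add_comm, mul_comm s]

theorem exists_adjugate_eq_sum (𝕜 n : Type*) [Field 𝕜] [CharZero 𝕜] [Fintype n]
    [DecidableEq n] :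
    ∃ c : ℕ → 𝕜, ∀ W M : Matrix n n 𝕜, W.adjugate =
      ∑ k ∈ Finset.range (Fintype.card n + 1), c k • (W + (k + 1) • M).adjugate := by
  obtain ⟨c, hc⟩ := exists_eval_zero_eq_sum 𝕜 (Fintype.card n)
  refine ⟨c, fun W M => Matrix.ext fun i j => ?_⟩
  obtain ⟨p, hp, hpe⟩ := exists_polynomial_eval_eq_adjugate W M i j
  simpa only [hpe, zero_smul, add_zero, Nat.cast_smul_eq_nsmul, Matrix.sum_apply,
    Matrix.smul_apply, smul_eq_mul] using hc p hp

theorem posDef_add_nsmul {𝕜 n : Type*} [RCLike 𝕜] {W M : Matrix n n 𝕜} (hW : W.PosDef) (hM : 0 ≤ M)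
    (k : ℕ) : (W + k • M).PosDef :=
  hW.add_posSemidef (nonneg_iff_posSemidef.1 (nsmul_nonneg hM k))

section Pencil

variable {𝕜 n : Type*} [RCLike 𝕜] [Fintype n] [DecidableEq n]

theorem norm_det_add_nsmul_le {W M : Matrix n n 𝕜} {a : ℝ} (hW : W.PosDef) (hM : 0 ≤ M)
    (hMW : M ≤ a • W) (k : ℕ) :
    ‖(W + k • M).det‖ ≤ (1 + k * a) ^ Fintype.card n * ‖W.det‖ := by
  refine norm_det_le_pow_mul hW (posDef_add_nsmul hW hM k).posSemidef.nonneg ?_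
  calc W + k • M ≤ W + k • a • W := by gcongr
    _ = (1 + k * a) • W := by module

theorem exists_inv_eq_sum (𝕜 n : Type*) [RCLike 𝕜] [Fintype n] [DecidableEq n] (a : ℝ) :
    ∃ b : ℕ → ℝ, ∀ W M : Matrix n n 𝕜, W.PosDef → 0 ≤ M → M ≤ a • W →
      ∃ r : ℕ → 𝕜, (∀ k, ‖r k‖ ≤ b k) ∧
        W⁻¹ = ∑ k ∈ Finset.range (Fintype.card n + 1), r k • (W + (k + 1) • M)⁻¹ := by
  obtain ⟨c, hc⟩ := exists_adjugate_eq_sum 𝕜 n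
  refine ⟨fun k => ‖c k‖ * (1 + (k + 1 : ℕ) * a) ^ Fintype.card n, fun W M hW hM hMW =>
    ⟨fun k => c k * ((W + (k + 1) • M).det / W.det), fun k => ?_, ?_⟩⟩
  · rw [norm_mul, norm_div]
    refine mul_le_mul_of_nonneg_left ?_ (norm_nonneg _)
    rw [div_le_iff₀ (norm_pos_iff.2 hW.det_pos.ne')]
    exact norm_det_add_nsmul_le hW hM hMW (k + 1)
  · rw [inv_def, Ring.inverse_eq_inv', hc W M, Finset.smul_sum]
    refine Finset.sum_congr rfl fun k _ => ?_
    have hdet := (posDef_add_nsmul hW hM (k + 1)).det_pos.ne'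
    rw [inv_def, Ring.inverse_eq_inv', smul_smul, smul_smul]
    congr 1
    field_simp

theorem exists_quadForm_inv_mulVec_le (𝕜 n : Type*) [RCLike 𝕜] [Fintype n] [DecidableEq n]
    (a : ℝ) :
    ∃ C : ℝ, 0 ≤ C ∧ ∀ W M D : Matrix n n 𝕜, W.PosDef → 0 ≤ M → M ≤ a • W → 0 ≤ D →
      ∀ v : n → 𝕜, quadForm D (W⁻¹ *ᵥ v) ≤
        C * ∑ k ∈ Finset.range (Fintype.card n + 1),
          quadForm D ((W + (k + 1) • M)⁻¹ *ᵥ v) := by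
  obtain ⟨b, hb⟩ := exists_inv_eq_sum 𝕜 n a
  refine ⟨∑ k ∈ Finset.range (Fintype.card n + 1), b k ^ 2, by positivity,
    fun W M D hW hM hMW hD v => ?_⟩
  obtain ⟨r, hr, hinv⟩ := hb W M hW hM hMW
  rw [hinv, sum_mulVec]
  simp only [smul_mulVec]
  refine (quadForm_sum_smul_le hD _ r _).trans ?_
  gcongr with k
  · exact Finset.sum_nonneg fun k _ => quadForm_nonneg hD _
  · exact hr k

/-- The sum over `s = 1, …, d + 1` of the energies `⟨(V + s M)⁻¹ v, v⟩`: the Bellman function of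
the weighted embedding theorem. Several regularizations are needed because
`exists_quadForm_inv_mulVec_le` extrapolates from `d + 1` nodes. -/
noncomputable def regularizedEnergy (V M : Matrix n n 𝕜) (v : n → 𝕜) : ℝ :=
  ∑ k ∈ Finset.range (Fintype.card n + 1), quadForm (V + (k + 1) • M)⁻¹ v

theorem regularizedEnergy_zero (V : Matrix n n 𝕜) (v : n → 𝕜) :
    regularizedEnergy V 0 v = (Fintype.card n + 1) * quadForm V⁻¹ v := by
  simp [regularizedEnergy]

theorem regularizedEnergy_nonneg {V M : Matrix n n 𝕜} (hV : V.PosDef) (hM : 0 ≤ M)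
    (v : n → 𝕜) : 0 ≤ regularizedEnergy V M v :=
  Finset.sum_nonneg fun _ _ => quadForm_nonneg (posDef_add_nsmul hV hM _).inv.posSemidef.nonneg v

theorem regularizedEnergy_add_le {V₁ V₂ M₁ M₂ D : Matrix n n 𝕜} (hV₁ : V₁.PosDef)
    (hV₂ : V₂.PosDef) (hM₁ : 0 ≤ M₁) (hM₂ : 0 ≤ M₂) (hD : 0 ≤ D) (v₁ v₂ : n → 𝕜) :
    regularizedEnergy (V₁ + V₂) (M₁ + M₂ + D) (v₁ + v₂) +
        ∑ k ∈ Finset.range (Fintype.card n + 1),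
          quadForm D ((V₁ + V₂ + (k + 1) • (M₁ + M₂ + D))⁻¹ *ᵥ (v₁ + v₂)) ≤
      regularizedEnergy V₁ M₁ v₁ + regularizedEnergy V₂ M₂ v₂ := by
  simp only [regularizedEnergy, ← Finset.sum_add_distrib]
  refine Finset.sum_le_sum fun k _ => ?_
  have hsplit : V₁ + (k + 1) • M₁ + (V₂ + (k + 1) • M₂) + (k + 1) • D =
      V₁ + V₂ + (k + 1) • (M₁ + M₂ + D) := by module
  have h := quadForm_inv_add_add_le (posDef_add_nsmul hV₁ hM₁ (k + 1))
    (posDef_add_nsmul hV₂ hM₂ (k + 1)) (nsmul_nonneg hD (k + 1)) v₁ v₂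
  rw [hsplit] at h
  refine le_trans ?_ h
  gcongr
  exact quadForm_mono (le_self_nsmul hD k.succ_ne_zero) _

end Pencil
end MatrixCarleson

/-! ### The dyadic tree -/

namespace DyadicInterval

/-- The left child of a dyadic interval. -/
def left (Q : DyadicInterval) : DyadicInterval :=
  ⟨Q.level + 1, 2 * Q.pos, by have := Q.pos.2; rw [pow_succ]; omega⟩

/-- The right child of a dyadic interval. -/
def right (Q : DyadicInterval) : DyadicInterval :=
  ⟨Q.level + 1, 2 * Q.pos + 1, by have := Q.pos.2; rw [pow_succ]; omega⟩

/-- The interval `[0, 1)`, the root of the tree of dyadic intervals. -/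
def root : DyadicInterval := ⟨0, 0⟩

theorem toSet_left (Q : DyadicInterval) : Q.left.toSet =
    Set.Ico ((Q.pos : ℝ) / 2 ^ Q.level) (((Q.pos : ℝ) + 1 / 2) / 2 ^ Q.level) := by
  simp only [toSet, left, pow_succ]
  push_cast
  congr 1 <;> field_simp

theorem toSet_right (Q : DyadicInterval) : Q.right.toSet =
    Set.Ico (((Q.pos : ℝ) + 1 / 2) / 2 ^ Q.level) (((Q.pos : ℝ) + 1) / 2 ^ Q.level) := by
  simp only [toSet, right, pow_succ]
  push_cast
  congr 1 <;> field_simp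
  ring

theorem toSet_root : root.toSet = Set.Ico 0 1 := by
  simp [root, toSet]

theorem nonempty_toSet (Q : DyadicInterval) : Q.toSet.Nonempty :=
  Set.nonempty_Ico.2 (by gcongr; linarith)

theorem left_union_right (Q : DyadicInterval) : Q.left.toSet ∪ Q.right.toSet = Q.toSet := by
  rw [toSet_left, toSet_right, toSet]
  exact Set.Ico_union_Ico_eq_Ico (by gcongr; linarith) (by gcongr; norm_num)

theorem disjoint_left_right (Q : DyadicInterval) : Disjoint Q.left.toSet Q.right.toSet := by
  rw [toSet_left, toSet_right]
  exact Set.Ico_disjoint_Ico_same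

theorem left_subset (Q : DyadicInterval) : Q.left.toSet ⊆ Q.toSet :=
  Q.left_union_right ▸ Set.subset_union_left

theorem right_subset (Q : DyadicInterval) : Q.right.toSet ⊆ Q.toSet :=
  Q.left_union_right ▸ Set.subset_union_right

theorem toSet_subset_iff {P Q : DyadicInterval} : P.toSet ⊆ Q.toSet ↔
    (Q.pos : ℕ) * 2 ^ P.level ≤ P.pos * 2 ^ Q.level ∧
      ((P.pos : ℕ) + 1) * 2 ^ Q.level ≤ (Q.pos + 1) * 2 ^ P.level := by
  have hP : (0 : ℝ) < 2 ^ P.level := by positivity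
  have hQ : (0 : ℝ) < 2 ^ Q.level := by positivity
  rw [toSet, toSet, Set.Ico_subset_Ico_iff (by gcongr; linarith), div_le_div_iff₀ hQ hP,
    div_le_div_iff₀ hP hQ]
  exact_mod_cast Iff.rfl

theorem toSet_subset_root (Q : DyadicInterval) : Q.toSet ⊆ root.toSet := by
  rw [toSet_subset_iff]
  simp [root]

theorem level_le_of_toSet_subset {P Q : DyadicInterval} (h : P.toSet ⊆ Q.toSet) :
    Q.level ≤ P.level := by
  obtain ⟨hl, hr⟩ := toSet_subset_iff.1 h
  have hpow : 2 ^ Q.level ≤ 2 ^ P.level := by linarith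
  exact (Nat.pow_le_pow_iff_right one_lt_two).1 hpow

theorem eq_of_toSet_subset_of_level_le {P Q : DyadicInterval} (h : P.toSet ⊆ Q.toSet)
    (hlevel : P.level ≤ Q.level) : P = Q := by
  obtain ⟨hl, hr⟩ := toSet_subset_iff.1 h
  have hPQ : P.level = Q.level := hlevel.antisymm (level_le_of_toSet_subset h)
  obtain ⟨k, p⟩ := P
  obtain ⟨l, q⟩ := Q
  obtain rfl : k = l := hPQ
  have hpos := pow_pos (two_pos (α := ℕ)) k
  have hqp : (q : ℕ) ≤ p := Nat.le_of_mul_le_mul_right hl hpos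
  have hpq : (p : ℕ) + 1 ≤ q + 1 := Nat.le_of_mul_le_mul_right hr hpos
  obtain rfl : p = q := Fin.ext (by omega)
  rfl

theorem subset_left_or_subset_right {P Q : DyadicInterval} (h : P.toSet ⊆ Q.toSet)
    (hlevel : Q.level < P.level) : P.toSet ⊆ Q.left.toSet ∨ P.toSet ⊆ Q.right.toSet := by
  obtain ⟨m, hm⟩ := Nat.exists_eq_add_of_lt hlevel
  obtain ⟨hl, hr⟩ := toSet_subset_iff.1 h
  have hmid : (2 * (Q.pos : ℕ) + 1) * 2 ^ P.level =
      (2 * Q.pos + 1) * 2 ^ m * 2 ^ (Q.level + 1) := by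
    rw [hm]
    ring
  simp only [toSet_subset_iff, left, right, hmid]
  rcases lt_or_ge (P.pos : ℕ) ((2 * Q.pos + 1) * 2 ^ m) with hlt | hge
  · exact .inl ⟨by rw [pow_succ]; linarith, Nat.mul_le_mul_right _ hlt⟩
  · exact .inr ⟨Nat.mul_le_mul_right _ hge, by rw [pow_succ]; linarith⟩

@[elab_as_elim]
theorem induction_from_level {p : DyadicInterval → Prop} (N : ℕ)
    (leaf : ∀ Q : DyadicInterval, N ≤ Q.level → p Q)
    (node : ∀ Q : DyadicInterval, Q.level < N → p Q.left → p Q.right → p Q)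
    (Q : DyadicInterval) : p Q := by
  rcases lt_or_ge Q.level N with h | h
  · exact node Q h (induction_from_level N leaf node Q.left)
      (induction_from_level N leaf node Q.right)
  · exact leaf Q h
termination_by N - Q.level
decreasing_by all_goals simp only [left, right]; omega

theorem finite_setOf_level_lt (N : ℕ) : {P : DyadicInterval | P.level < N}.Finite :=
  (Set.finite_range fun x : Σ k : Fin N, Fin (2 ^ (k : ℕ)) => (⟨x.1, x.2⟩ : DyadicInterval)).subset
    fun P hP => ⟨⟨⟨P.level, hP⟩, P.pos⟩, rfl⟩

/-- The dyadic subintervals of `Q` of generation less than `N`. -/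
noncomputable def below (N : ℕ) (Q : DyadicInterval) : Finset DyadicInterval :=
  ((finite_setOf_level_lt N).inter_of_right {P | P.toSet ⊆ Q.toSet}).toFinset

theorem mem_below {N : ℕ} {P Q : DyadicInterval} :
    P ∈ below N Q ↔ P.toSet ⊆ Q.toSet ∧ P.level < N := by
  simp [below]

theorem below_eq_empty {N : ℕ} {Q : DyadicInterval} (h : N ≤ Q.level) : below N Q = ∅ :=
  Finset.eq_empty_of_forall_notMem fun P hP => by
    have := level_le_of_toSet_subset (mem_below.1 hP).1
    have := (mem_below.1 hP).2
    omega

theorem disjoint_below_left_right (N : ℕ) (Q : DyadicInterval) :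
    Disjoint (below N Q.left) (below N Q.right) :=
  Finset.disjoint_left.2 fun P hl hr =>
    P.nonempty_toSet.ne_empty <| Set.subset_empty_iff.1 <|
      Q.disjoint_left_right (mem_below.1 hl).1 (mem_below.1 hr).1

theorem notMem_below_of_level_lt {N : ℕ} {P Q : DyadicInterval} (h : Q.level < P.level) :
    Q ∉ below N P :=
  fun hQ => (level_le_of_toSet_subset (mem_below.1 hQ).1).not_gt h

theorem below_eq_insert [DecidableEq DyadicInterval] {N : ℕ} {Q : DyadicInterval}
    (h : Q.level < N) : below N Q = insert Q (below N Q.left ∪ below N Q.right) := by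
  ext P
  simp only [Finset.mem_insert, Finset.mem_union, mem_below]
  constructor
  · rintro ⟨hPQ, hP⟩
    rcases le_or_gt P.level Q.level with hle | hlt
    · exact .inl (eq_of_toSet_subset_of_level_le hPQ hle)
    · exact .inr ((subset_left_or_subset_right hPQ hlt).imp (⟨·, hP⟩) (⟨·, hP⟩))
  · rintro (rfl | ⟨hP, hPN⟩ | ⟨hP, hPN⟩)
    · exact ⟨subset_rfl, h⟩
    · exact ⟨hP.trans Q.left_subset, hPN⟩
    · exact ⟨hP.trans Q.right_subset, hPN⟩

theorem sum_below {M : Type*} [AddCommMonoid M] (a : DyadicInterval → M) {N : ℕ}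
    {Q : DyadicInterval} (h : Q.level < N) :
    ∑ P ∈ below N Q, a P = a Q + (∑ P ∈ below N Q.left, a P + ∑ P ∈ below N Q.right, a P) := by
  classical
  rw [below_eq_insert h, Finset.sum_insert, Finset.sum_union (disjoint_below_left_right N Q)]
  rw [Finset.mem_union, not_or]
  exact ⟨notMem_below_of_level_lt Q.level.lt_succ_self,
    notMem_below_of_level_lt Q.level.lt_succ_self⟩

theorem tsum_le_of_sum_below_root_le {a : DyadicInterval → ℝ≥0∞} {b : ℝ≥0∞}
    (h : ∀ N, ∑ P ∈ below N root, a P ≤ b) : ∑' Q, a Q ≤ b := by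
  rw [ENNReal.tsum_eq_iSup_sum]
  refine iSup_le fun s => le_trans (Finset.sum_le_sum_of_subset fun P hP => ?_)
    (h (s.sup level + 1))
  exact mem_below.2 ⟨P.toSet_subset_root, Nat.lt_succ_of_le (Finset.le_sup (f := level) hP)⟩

/-- Additivity of an interval function: its value at an interval is the sum of its values at the
two children. -/
def IsAdditive {M : Type*} [Add M] (a : DyadicInterval → M) : Prop :=
  ∀ Q : DyadicInterval, a Q = a Q.left + a Q.right

end DyadicInterval

namespace MatrixCarleson

open Matrix DyadicInterval

/-! ### Splitting a Carleson sequence -/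

section Splitting

variable {E : Type*} [AddCommGroup E] [Module ℝ E]

/-- The multiple of `x` of mass `t`; it is `0` if `mass x = 0`. -/
noncomputable def scaleToMass (mass : E →ₗ[ℝ] ℝ) (t : ℝ) (x : E) : E := (t / mass x) • x

theorem mass_scaleToMass {mass : E →ₗ[ℝ] ℝ} {t : ℝ} {x : E} (ht : 0 ≤ t) (htx : t ≤ mass x) :
    mass (scaleToMass mass t x) = t := by
  rw [scaleToMass, map_smul, smul_eq_mul]
  obtain hx | hx := eq_or_ne (mass x) 0
  · rw [hx, mul_zero, ht.antisymm (htx.trans_eq hx)]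
  · exact div_mul_cancel₀ t hx

theorem scaleToMass_mem {K : PointedCone ℝ E} {mass : E →ₗ[ℝ] ℝ} {t : ℝ} {x : E} (hx : x ∈ K)
    (ht : 0 ≤ t) (hmass : 0 ≤ mass x) : scaleToMass mass t x ∈ K :=
  K.smul_mem (div_nonneg ht hmass) hx

theorem sub_scaleToMass_mem {K : PointedCone ℝ E} {mass : E →ₗ[ℝ] ℝ} {t : ℝ} {x : E} (hx : x ∈ K)
    (ht : 0 ≤ t) (htx : t ≤ mass x) : x - scaleToMass mass t x ∈ K := by
  rw [scaleToMass, show x - (t / mass x) • x = (1 - t / mass x) • x by module]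
  exact K.smul_mem (sub_nonneg.2 (div_le_one_of_le₀ htx (ht.trans htx))) hx

/-- What is left of `V Q` after the intervals of generation less than `N` have been processed from
the smallest to the largest, each removing mass `α` from what its children left over. -/
noncomputable def residual (mass : E →ₗ[ℝ] ℝ) (V : DyadicInterval → E) (α : DyadicInterval → ℝ)
    (N : ℕ) (Q : DyadicInterval) : E :=
  if Q.level < N then
    let x := residual mass V α N Q.left + residual mass V α N Q.right
    x - scaleToMass mass (α Q) x
  else V Q
termination_by N - Q.level
decreasing_by all_goals simp only [left, right]; omega

/-- The portion that `Q` removes in the construction of `residual`. -/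
noncomputable def removed (mass : E →ₗ[ℝ] ℝ) (V : DyadicInterval → E) (α : DyadicInterval → ℝ)
    (N : ℕ) (Q : DyadicInterval) : E :=
  scaleToMass mass (α Q) (residual mass V α N Q.left + residual mass V α N Q.right)

variable {mass : E →ₗ[ℝ] ℝ} {V : DyadicInterval → E} {α : DyadicInterval → ℝ} {N : ℕ}

theorem residual_of_level_lt {Q : DyadicInterval} (h : Q.level < N) :
    residual mass V α N Q = residual mass V α N Q.left + residual mass V α N Q.right -
      removed mass V α N Q := by
  rw [residual, if_pos h, removed]

theorem residual_of_le_level {Q : DyadicInterval} (h : N ≤ Q.level) :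
    residual mass V α N Q = V Q := by
  rw [residual, if_neg h.not_gt]

theorem residual_eq_sub_sum (hV : IsAdditive V) (Q : DyadicInterval) :
    residual mass V α N Q = V Q - ∑ P ∈ below N Q, removed mass V α N P := by
  induction Q using induction_from_level N with
  | leaf Q h => rw [residual_of_le_level h, below_eq_empty h, Finset.sum_empty, sub_zero]
  | node Q h ihl ihr =>
    rw [residual_of_level_lt h, ihl, ihr, sum_below _ h, hV Q]
    abel

theorem le_mass_residual_add_residual (hV : IsAdditive V)
    (hpack : ∀ Q, ∑ P ∈ below N Q, α P ≤ mass (V Q)) {Q : DyadicInterval} (hQ : Q.level < N)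
    (hl : mass (residual mass V α N Q.left) = mass (V Q.left) - ∑ P ∈ below N Q.left, α P)
    (hr : mass (residual mass V α N Q.right) = mass (V Q.right) - ∑ P ∈ below N Q.right, α P) :
    α Q ≤ mass (residual mass V α N Q.left + residual mass V α N Q.right) := by
  have h := hpack Q
  rw [sum_below _ hQ, hV Q, map_add] at h
  rw [map_add, hl, hr]
  linarith

theorem mass_residual (hV : IsAdditive V) (hα : ∀ Q, 0 ≤ α Q)
    (hpack : ∀ Q, ∑ P ∈ below N Q, α P ≤ mass (V Q)) (Q : DyadicInterval) :
    mass (residual mass V α N Q) = mass (V Q) - ∑ P ∈ below N Q, α P := by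
  induction Q using induction_from_level N with
  | leaf Q h => rw [residual_of_le_level h, below_eq_empty h, Finset.sum_empty, sub_zero]
  | node Q h ihl ihr =>
    rw [residual_of_level_lt h, map_sub, removed,
      mass_scaleToMass (hα Q) (le_mass_residual_add_residual hV hpack h ihl ihr), map_add, ihl,
      ihr, sum_below _ h, hV Q, map_add]
    ring

theorem residual_mem {K : PointedCone ℝ E} (hV : IsAdditive V) (hVK : ∀ Q, V Q ∈ K)
    (hα : ∀ Q, 0 ≤ α Q) (hpack : ∀ Q, ∑ P ∈ below N Q, α P ≤ mass (V Q)) (Q : DyadicInterval) :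
    residual mass V α N Q ∈ K := by
  induction Q using induction_from_level N with
  | leaf Q h =>
    rw [residual_of_le_level h]
    exact hVK Q
  | node Q h ihl ihr =>
    rw [residual_of_level_lt h]
    exact sub_scaleToMass_mem (K.add_mem ihl ihr) (hα Q) (le_mass_residual_add_residual hV hpack h
      (mass_residual hV hα hpack _) (mass_residual hV hα hpack _))

theorem exists_cone_valued_splitting {K : PointedCone ℝ E} (hV : IsAdditive V)
    (hVK : ∀ Q, V Q ∈ K) (hα : ∀ Q, 0 ≤ α Q)
    (hpack : ∀ Q, ∑ P ∈ below N Q, α P ≤ mass (V Q)) :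
    ∃ D : DyadicInterval → E, (∀ Q, D Q ∈ K) ∧ (∀ Q, Q.level < N → mass (D Q) = α Q) ∧
      ∀ Q, V Q - ∑ P ∈ below N Q, D P ∈ K := by
  have hK := residual_mem hV hVK hα hpack
  have hmass := mass_residual hV hα hpack
  have hnonneg Q : 0 ≤ mass (residual mass V α N Q) := by
    rw [hmass]
    exact sub_nonneg.2 (hpack Q)
  refine ⟨removed mass V α N, fun Q => ?_, fun Q hQ => ?_, fun Q => ?_⟩
  · refine scaleToMass_mem (K.add_mem (hK _) (hK _)) (hα Q) ?_
    rw [map_add]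
    exact add_nonneg (hnonneg _) (hnonneg _)
  · exact mass_scaleToMass (hα Q)
      (le_mass_residual_add_residual hV hpack hQ (hmass _) (hmass _))
  · exact residual_eq_sub_sum hV Q ▸ hK Q

end Splitting

section PairingCone

variable {𝕜 n : Type*} [RCLike 𝕜] [Fintype n]

/-- The cone of triples `(X, Y, c)` for which the positive semidefinite matrices `X` and `Y`
dominate `c` times the duality pairing: the block matrix with diagonal blocks `X`, `Y` and
off-diagonal blocks `c • 1` is positive semidefinite. -/
def pairingCone (𝕜 n : Type*) [RCLike 𝕜] [Fintype n] :
    PointedCone ℝ (Matrix n n 𝕜 × Matrix n n 𝕜 × ℝ) where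
  carrier := {x | 0 ≤ x.1 ∧ 0 ≤ x.2.1 ∧
    ∀ v w, 2 * x.2.2 * ‖star v ⬝ᵥ w‖ ≤ quadForm x.1 v + quadForm x.2.1 w}
  zero_mem' := by simp [quadForm]
  add_mem' := by
    rintro x y ⟨hx₁, hx₂, hx⟩ ⟨hy₁, hy₂, hy⟩
    refine ⟨add_nonneg hx₁ hy₁, add_nonneg hx₂ hy₂, fun v w => ?_⟩
    simp only [Prod.fst_add, Prod.snd_add, quadForm_add]
    linarith [hx v w, hy v w]
  smul_mem' := by
    rintro ⟨c, hc⟩ x ⟨hx₁, hx₂, hx⟩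
    refine ⟨smul_nonneg hc hx₁, smul_nonneg hc hx₂, fun v w => ?_⟩
    have h := mul_le_mul_of_nonneg_left (hx v w) hc
    simp only [Nonneg.mk_smul, Prod.smul_fst, Prod.smul_snd, quadForm_smul, smul_eq_mul]
    linarith

theorem mem_pairingCone {X Y : Matrix n n 𝕜} {c : ℝ} : (X, Y, c) ∈ pairingCone 𝕜 n ↔
    0 ≤ X ∧ 0 ≤ Y ∧ ∀ v w, 2 * c * ‖star v ⬝ᵥ w‖ ≤ quadForm X v + quadForm Y w :=
  Iff.rfl

theorem le_sqrt_mul_sqrt_of_forall_two_mul_le {s x y : ℝ} (hx : 0 ≤ x)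
    (h : ∀ r : ℝ, 2 * r * s ≤ r ^ 2 * x + y) : s ≤ √x * √y := by
  have hdiscr : discrim x (-(2 * s)) y ≤ 0 :=
    discrim_le_zero fun r => by linarith [h r]
  rw [← Real.sqrt_mul hx]
  refine Real.le_sqrt_of_sq_le ?_
  rw [discrim] at hdiscr
  linarith

theorem mul_norm_dotProduct_le_sqrt_mul_sqrt {X Y : Matrix n n 𝕜} {c : ℝ}
    (h : (X, Y, c) ∈ pairingCone 𝕜 n) (hc : 0 ≤ c) (v w : n → 𝕜) :
    c * ‖star v ⬝ᵥ w‖ ≤ √(quadForm X v) * √(quadForm Y w) := by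
  obtain ⟨hX, -, h⟩ := mem_pairingCone.1 h
  refine le_sqrt_mul_sqrt_of_forall_two_mul_le (quadForm_nonneg hX v) fun r => ?_
  have hr := h ((r : 𝕜) • v) w
  rw [quadForm_smul_vec, star_smul, smul_dotProduct, norm_smul, norm_star, RCLike.norm_ofReal,
    sq_abs] at hr
  have habs : r * (c * ‖star v ⬝ᵥ w‖) ≤ |r| * (c * ‖star v ⬝ᵥ w‖) := by
    gcongr
    exact le_abs_self r
  linarith

end PairingCone

/-! ### The weighted Carleson embedding -/

section Embedding

variable {𝕜 n : Type*} [RCLike 𝕜] [Fintype n] [DecidableEq n]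

/-- The abstract data of the one-weight embedding: matrix masses `V Q`, vector masses `F Q` and
energies `e Q`, additive in `Q`, such that `e Q` dominates the energy of `F Q` relative to
`V Q`. -/
structure IsWeightedFamily (V : DyadicInterval → Matrix n n 𝕜) (F : DyadicInterval → n → 𝕜)
    (e : DyadicInterval → ℝ) : Prop where
  posDef : ∀ Q, (V Q).PosDef
  additive_weight : IsAdditive V
  additive_vector : IsAdditive F
  additive_energy : IsAdditive e
  quadForm_inv_le : ∀ Q, quadForm (V Q)⁻¹ (F Q) ≤ e Q

theorem IsWeightedFamily.sum_add_regularizedEnergy_le {V D : DyadicInterval → Matrix n n 𝕜}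
    {F : DyadicInterval → n → 𝕜} {e : DyadicInterval → ℝ} (h : IsWeightedFamily V F e)
    (hD : ∀ Q, 0 ≤ D Q) {N : ℕ} {C : ℝ} (hC : 0 ≤ C)
    (hgain : ∀ Q, quadForm (D Q) ((V Q)⁻¹ *ᵥ F Q) ≤
      C * ∑ k ∈ Finset.range (Fintype.card n + 1),
        quadForm (D Q) ((V Q + (k + 1) • ∑ P ∈ below N Q, D P)⁻¹ *ᵥ F Q))
    (Q : DyadicInterval) :
    ∑ P ∈ below N Q, quadForm (D P) ((V P)⁻¹ *ᵥ F P) +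
        C * regularizedEnergy (V Q) (∑ P ∈ below N Q, D P) (F Q) ≤
      C * (Fintype.card n + 1) * e Q := by
  induction Q using induction_from_level N with
  | leaf Q hQ =>
    rw [below_eq_empty hQ, Finset.sum_empty, Finset.sum_empty, zero_add, regularizedEnergy_zero,
      mul_assoc]
    gcongr
    exact h.quadForm_inv_le Q
  | node Q hQ ihl ihr =>
    have hnonneg P : 0 ≤ ∑ R ∈ below N P, D R := Finset.sum_nonneg fun R _ => hD R
    have hstep := mul_le_mul_of_nonneg_left (regularizedEnergy_add_le (h.posDef Q.left)
      (h.posDef Q.right) (hnonneg Q.left) (hnonneg Q.right) (hD Q) (F Q.left) (F Q.right)) hC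
    rw [add_comm _ (D Q), ← sum_below D hQ, ← h.additive_weight Q, ← h.additive_vector Q,
      mul_add, mul_add] at hstep
    rw [sum_below _ hQ, h.additive_energy Q]
    linarith [hgain Q]

/-- The matrix Carleson embedding theorem. -/
theorem exists_sum_quadForm_le (𝕜 n : Type*) [RCLike 𝕜] [Fintype n] [DecidableEq n] (a : ℝ) :
    ∃ C : ℝ, 0 ≤ C ∧ ∀ (V D : DyadicInterval → Matrix n n 𝕜) (F : DyadicInterval → n → 𝕜)
      (e : DyadicInterval → ℝ), IsWeightedFamily V F e → (∀ Q, 0 ≤ D Q) →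
      ∀ N, (∀ Q, ∑ P ∈ below N Q, D P ≤ a • V Q) →
        ∀ Q, ∑ P ∈ below N Q, quadForm (D P) ((V P)⁻¹ *ᵥ F P) ≤ C * e Q := by
  obtain ⟨C, hC, hCle⟩ := exists_quadForm_inv_mulVec_le 𝕜 n a
  refine ⟨C * (Fintype.card n + 1), by positivity, fun V D F e h hD N hpack Q => ?_⟩
  have hnonneg Q : 0 ≤ ∑ P ∈ below N Q, D P := Finset.sum_nonneg fun P _ => hD P
  have hgain Q := hCle (V Q) _ (D Q) (h.posDef Q) (hnonneg Q) (hpack Q) (hD Q) (F Q)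
  refine le_trans ?_ (h.sum_add_regularizedEnergy_le hD hC hgain Q)
  exact le_add_of_nonneg_right
    (mul_nonneg hC (regularizedEnergy_nonneg (h.posDef Q) (hnonneg Q) _))

theorem exists_matrix_splitting {𝕜 n : Type*} [RCLike 𝕜] [Fintype n]
    {V V' : DyadicInterval → Matrix n n 𝕜} {c : DyadicInterval → ℝ}
    (hV : IsAdditive V) (hV' : IsAdditive V') (hc : IsAdditive c)
    (hcone : ∀ Q, (V Q, V' Q, c Q) ∈ pairingCone 𝕜 n) {a : ℝ} (ha : 0 ≤ a)
    {α : DyadicInterval → ℝ} (hα : ∀ Q, 0 ≤ α Q) {N : ℕ}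
    (hpack : ∀ Q, ∑ P ∈ below N Q, α P ≤ a * c Q) :
    ∃ D D' : DyadicInterval → Matrix n n 𝕜, (∀ Q, 0 ≤ D Q) ∧ (∀ Q, 0 ≤ D' Q) ∧
      (∀ Q, Q.level < N → (D Q, D' Q, α Q) ∈ pairingCone 𝕜 n) ∧
      (∀ Q, ∑ P ∈ below N Q, D P ≤ a • V Q) ∧ ∀ Q, ∑ P ∈ below N Q, D' P ≤ a • V' Q := by
  let mass : Matrix n n 𝕜 × Matrix n n 𝕜 × ℝ →ₗ[ℝ] ℝ :=
    LinearMap.snd ℝ _ _ ∘ₗ LinearMap.snd ℝ _ _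
  have hadd : IsAdditive fun Q => a • (V Q, V' Q, c Q) := fun Q => by
    rw [← smul_add, Prod.mk_add_mk, Prod.mk_add_mk, ← hV Q, ← hV' Q, ← hc Q]
  obtain ⟨D, hDK, hmass, hres⟩ := exists_cone_valued_splitting (mass := mass) hadd
    (fun Q => (pairingCone 𝕜 n).smul_mem ha (hcone Q)) hα hpack
  refine ⟨fun Q => (D Q).1, fun Q => (D Q).2.1, fun Q => (hDK Q).1, fun Q => (hDK Q).2.1,
    fun Q hQ => hmass Q hQ ▸ hDK Q, fun Q => ?_, fun Q => ?_⟩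
  · simpa only [Prod.fst_sub, Prod.smul_fst, Prod.fst_sum, sub_nonneg] using (hres Q).1
  · simpa only [Prod.fst_sub, Prod.snd_sub, Prod.smul_fst, Prod.smul_snd, Prod.fst_sum,
      Prod.snd_sum, sub_nonneg] using (hres Q).2.1

theorem exists_sum_pairing_le (𝕜 n : Type*) [RCLike 𝕜] [Fintype n] [DecidableEq n] {a : ℝ}
    (ha : 0 ≤ a) :
    ∃ C : ℝ, 0 ≤ C ∧ ∀ (V V' : DyadicInterval → Matrix n n 𝕜) (F F' : DyadicInterval → n → 𝕜)
      (e e' c : DyadicInterval → ℝ), IsWeightedFamily V F e → IsWeightedFamily V' F' e' →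
      IsAdditive c → (∀ Q, (V Q, V' Q, c Q) ∈ pairingCone 𝕜 n) →
      ∀ (α : DyadicInterval → ℝ) (N : ℕ), (∀ Q, 0 ≤ α Q) →
        (∀ Q, ∑ P ∈ below N Q, α P ≤ a * c Q) →
        ∀ Q, ∑ P ∈ below N Q, α P * ‖star ((V P)⁻¹ *ᵥ F P) ⬝ᵥ ((V' P)⁻¹ *ᵥ F' P)‖ ≤
          C * (√(e Q) * √(e' Q)) := by
  obtain ⟨C, hC, hCle⟩ := exists_sum_quadForm_le 𝕜 n a
  refine ⟨C, hC, fun V V' F F' e e' c h h' hc hcone α N hα hpack Q => ?_⟩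
  obtain ⟨D, D', hD, hD', hDD', hsum, hsum'⟩ :=
    exists_matrix_splitting h.additive_weight h'.additive_weight hc hcone ha hα hpack
  calc ∑ P ∈ below N Q, α P * ‖star ((V P)⁻¹ *ᵥ F P) ⬝ᵥ ((V' P)⁻¹ *ᵥ F' P)‖
      ≤ ∑ P ∈ below N Q, √(quadForm (D P) ((V P)⁻¹ *ᵥ F P)) *
          √(quadForm (D' P) ((V' P)⁻¹ *ᵥ F' P)) :=
        Finset.sum_le_sum fun P hP =>
          mul_norm_dotProduct_le_sqrt_mul_sqrt (hDD' P (mem_below.1 hP).2) (hα P) _ _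
    _ ≤ √(∑ P ∈ below N Q, quadForm (D P) ((V P)⁻¹ *ᵥ F P)) *
          √(∑ P ∈ below N Q, quadForm (D' P) ((V' P)⁻¹ *ᵥ F' P)) :=
        Real.sum_sqrt_mul_sqrt_le _ (fun P => quadForm_nonneg (hD P) _)
          fun P => quadForm_nonneg (hD' P) _
    _ ≤ √(C * e Q) * √(C * e' Q) := by
        gcongr
        · exact hCle V D F e h hD N hsum Q
        · exact hCle V' D' F' e' h' hD' N hsum' Q
    _ = C * (√(e Q) * √(e' Q)) := by
        rw [Real.sqrt_mul hC, Real.sqrt_mul hC, mul_mul_mul_comm, Real.mul_self_sqrt hC]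

end Embedding

/-! ### Integrals of matrix weights -/

section Integral

variable {𝕜 n X : Type*} [RCLike 𝕜] [MeasurableSpace X] {μ : Measure X}

theorem integral_pos_of_ae_pos [NeZero μ] {h : X → ℝ} (hint : Integrable h μ)
    (hpos : ∀ᵐ x ∂μ, 0 < h x) : 0 < ∫ x, h x ∂μ := by
  have hsupp : Function.support h =ᵐ[μ] Set.univ :=
    Filter.eventuallyEq_univ.2 (hpos.mono fun x hx => hx.ne')
  rw [integral_pos_iff_support_of_nonneg_ae (hpos.mono fun x hx => hx.le) hint,
    measure_congr hsupp]
  exact Measure.measure_univ_pos.2 (NeZero.ne μ)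

/-- The entrywise integral of a matrix function. -/
noncomputable def matrixIntegral (μ : Measure X) (V : X → Matrix n n 𝕜) : Matrix n n 𝕜 :=
  Matrix.of fun i j => ∫ x, V x i j ∂μ

variable {V : X → Matrix n n 𝕜}

theorem isHermitian_matrixIntegral (hp : ∀ᵐ x ∂μ, (V x).IsHermitian) :
    (matrixIntegral μ V).IsHermitian := by
  ext i j
  rw [conjTranspose_apply, matrixIntegral, of_apply, of_apply, RCLike.star_def, ← integral_conj]
  refine integral_congr_ae ?_
  filter_upwards [hp] with x hx
  exact hx.apply i j

theorem aestronglyMeasurable_matrix [Countable n]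
    (hV : ∀ i j, AEStronglyMeasurable (fun x => V x i j) μ) :
    AEStronglyMeasurable V μ := by
  have h : AEMeasurable (β := n → n → 𝕜) (fun x i j => V x i j) μ :=
    aemeasurable_pi_iff.2 fun i => aemeasurable_pi_iff.2 fun j => (hV i j).aemeasurable
  exact h.aestronglyMeasurable

variable [Fintype n]

theorem integrable_dotProduct {F : X → n → 𝕜} (hF : ∀ i, Integrable (fun x => F x i) μ)
    (w : n → 𝕜) : Integrable (fun x => w ⬝ᵥ F x) μ :=
  integrable_finsetSum _ fun i _ => (hF i).const_mul (w i)

theorem dotProduct_integral {F : X → n → 𝕜} (hF : ∀ i, Integrable (fun x => F x i) μ)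
    (w : n → 𝕜) : (w ⬝ᵥ fun i => ∫ x, F x i ∂μ) = ∫ x, w ⬝ᵥ F x ∂μ := by
  simp only [dotProduct]
  rw [integral_finsetSum _ fun i _ => (hF i).const_mul (w i)]
  simp only [integral_const_mul]

theorem re_dotProduct_integral {F : X → n → 𝕜} (hF : ∀ i, Integrable (fun x => F x i) μ)
    (w : n → 𝕜) :
    RCLike.re (w ⬝ᵥ fun i => ∫ x, F x i ∂μ) = ∫ x, RCLike.re (w ⬝ᵥ F x) ∂μ := by
  rw [dotProduct_integral hF, integral_re (integrable_dotProduct hF w)]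

theorem integrable_mulVec_apply (hV : ∀ i j, Integrable (fun x => V x i j) μ) (w : n → 𝕜) (i : n) :
    Integrable (fun x => (V x *ᵥ w) i) μ := by
  simp only [mulVec, dotProduct_comm _ w]
  exact integrable_dotProduct (hV i) w

theorem matrixIntegral_mulVec (hV : ∀ i j, Integrable (fun x => V x i j) μ) (w : n → 𝕜) :
    matrixIntegral μ V *ᵥ w = fun i => ∫ x, (V x *ᵥ w) i ∂μ := by
  ext i
  simp only [mulVec, dotProduct_comm _ w]
  exact dotProduct_integral (hV i) w

theorem integrable_quadForm (hV : ∀ i j, Integrable (fun x => V x i j) μ) (w : n → 𝕜) :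
    Integrable (fun x => quadForm (V x) w) μ :=
  (integrable_dotProduct (integrable_mulVec_apply hV w) (star w)).re

theorem quadForm_matrixIntegral (hV : ∀ i j, Integrable (fun x => V x i j) μ) (w : n → 𝕜) :
    quadForm (matrixIntegral μ V) w = ∫ x, quadForm (V x) w ∂μ := by
  rw [quadForm, matrixIntegral_mulVec hV, re_dotProduct_integral (integrable_mulVec_apply hV w)]
  rfl

theorem posDef_matrixIntegral [NeZero μ] (hV : ∀ i j, Integrable (fun x => V x i j) μ)
    (hp : ∀ᵐ x ∂μ, (V x).PosDef) : (matrixIntegral μ V).PosDef := by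
  have hH := isHermitian_matrixIntegral (hp.mono fun x hx => hx.isHermitian)
  refine PosDef.of_dotProduct_mulVec_pos hH fun w hw => ?_
  have hpos : ∀ᵐ x ∂μ, 0 < quadForm (V x) w :=
    hp.mono fun x hx => (RCLike.pos_iff.1 (hx.dotProduct_mulVec_pos hw)).1
  have h : 0 < quadForm (matrixIntegral μ V) w := by
    rw [quadForm_matrixIntegral hV]
    exact integral_pos_of_ae_pos (integrable_quadForm hV w) hpos
  exact RCLike.pos_iff.2 ⟨h, hH.im_star_dotProduct_mulVec_self w⟩

variable [DecidableEq n]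

open scoped Matrix.Norms.L2Operator in
theorem continuous_sqrt_abs : Continuous fun X : Matrix n n 𝕜 => CFC.sqrt (CFC.abs X) := by
  -- The library states that the L2 operator norm is a normed algebra norm over `𝕜` only.
  let : NormedAlgebra ℝ (Matrix n n 𝕜) :=
    { norm_smul_le := fun r X => by rw [← algebraMap_smul 𝕜 r X, norm_smul, norm_algebraMap'] }
  exact CFC.continuousOn_sqrt.comp_continuous CFC.continuous_abs fun X => CFC.abs_nonneg X

theorem aestronglyMeasurable_sqrt (hV : ∀ i j, AEStronglyMeasurable (fun x => V x i j) μ)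
    (hp : ∀ᵐ x ∂μ, 0 ≤ V x) : AEStronglyMeasurable (fun x => CFC.sqrt (V x)) μ := by
  refine (continuous_sqrt_abs.comp_aestronglyMeasurable (aestronglyMeasurable_matrix hV)).congr ?_
  filter_upwards [hp] with x hx
  rw [CFC.abs_of_nonneg _ hx]

theorem norm_sqrt_mulVec_apply_le {X : Matrix n n 𝕜} (hX : 0 ≤ X) (v : n → 𝕜) (i : n) :
    ‖(CFC.sqrt X *ᵥ v) i‖ ≤ ‖X i i‖ + ‖WithLp.toLp 2 v‖ ^ 2 := by
  obtain ⟨c, hc, hcz⟩ := RCLike.exists_norm_eq_mul_self ((CFC.sqrt X *ᵥ v) i)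
  have h := two_re_dotProduct_sqrt_mulVec_le hX v (star c • Pi.single i 1)
  have hdiag : quadForm X (Pi.single i 1) ≤ ‖X i i‖ := by
    simpa [quadForm] using RCLike.re_le_norm (X i i)
  rw [star_smul, star_star, Pi.star_single, star_one, smul_dotProduct, single_one_dotProduct,
    smul_eq_mul, ← hcz, RCLike.ofReal_re, quadForm_smul_vec, norm_star, hc] at h
  linarith [norm_nonneg (X i i), norm_nonneg ((CFC.sqrt X *ᵥ v) i)]

variable {f : X → EuclideanSpace 𝕜 n}

theorem integrable_sqrt_mulVec (hV : ∀ i j, Integrable (fun x => V x i j) μ)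
    (hp : ∀ᵐ x ∂μ, 0 ≤ V x) (hf : MemLp f 2 μ) (i : n) :
    Integrable (fun x => (CFC.sqrt (V x) *ᵥ (f x).ofLp) i) μ := by
  refine ((hV i i).norm.add (hf.integrable_norm_pow two_ne_zero)).mono' ?_ ?_
  · have hS := aestronglyMeasurable_sqrt (fun i j => (hV i j).aestronglyMeasurable) hp
    have hc : Continuous fun p : Matrix n n 𝕜 × EuclideanSpace 𝕜 n => (p.1 *ᵥ p.2.ofLp) i :=
      (continuous_apply i).comp (continuous_fst.matrix_mulVec (by fun_prop))
    exact hc.comp_aestronglyMeasurable (hS.prodMk hf.aestronglyMeasurable)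
  · filter_upwards [hp] with x hx
    exact norm_sqrt_mulVec_apply_le hx (f x) i

/-- The coordinatewise integral of `V^{1/2} f`. -/
noncomputable def sqrtIntegral (μ : Measure X) (V : X → Matrix n n 𝕜) (f : X → EuclideanSpace 𝕜 n) :
    n → 𝕜 :=
  fun i => ∫ x, (CFC.sqrt (V x) *ᵥ (f x).ofLp) i ∂μ

theorem quadForm_inv_sqrtIntegral_le [NeZero μ] (hV : ∀ i j, Integrable (fun x => V x i j) μ)
    (hp : ∀ᵐ x ∂μ, (V x).PosDef) (hf : MemLp f 2 μ) :
    quadForm (matrixIntegral μ V)⁻¹ (sqrtIntegral μ V f) ≤ ∫ x, ‖f x‖ ^ 2 ∂μ := by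
  have hp' : ∀ᵐ x ∂μ, 0 ≤ V x := hp.mono fun x hx => hx.posSemidef.nonneg
  set w := (matrixIntegral μ V)⁻¹ *ᵥ sqrtIntegral μ V f with hw
  have hsqrt := integrable_sqrt_mulVec hV hp' hf
  have hquad := integrable_quadForm hV w
  have hnorm : Integrable (fun x => ‖f x‖ ^ 2) μ := hf.integrable_norm_pow two_ne_zero
  rw [quadForm_inv_eq (posDef_matrixIntegral hV hp), ← hw, sub_le_iff_le_add',
    show sqrtIntegral μ V f = fun i => ∫ x, _ ∂μ from rfl, re_dotProduct_integral hsqrt,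
    quadForm_matrixIntegral hV, ← integral_const_mul, ← integral_add hquad hnorm]
  refine integral_mono_ae ((integrable_dotProduct hsqrt _).re.const_mul 2) (hquad.add hnorm) ?_
  filter_upwards [hp'] with x hx
  exact two_re_dotProduct_sqrt_mulVec_le hx (f x) w

theorem matrixIntegral_mem_pairingCone [IsFiniteMeasure μ] [NeZero μ]
    (hV : ∀ i j, Integrable (fun x => V x i j) μ)
    (hV' : ∀ i j, Integrable (fun x => (V x)⁻¹ i j) μ) (hp : ∀ᵐ x ∂μ, (V x).PosDef) :
    (matrixIntegral μ V, matrixIntegral μ fun x => (V x)⁻¹, μ.real Set.univ) ∈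
      pairingCone 𝕜 n := by
  refine mem_pairingCone.2 ⟨(posDef_matrixIntegral hV hp).posSemidef.nonneg,
    (posDef_matrixIntegral hV' (hp.mono fun x hx => hx.inv)).posSemidef.nonneg, fun v w => ?_⟩
  have hquad := integrable_quadForm hV v
  have hquad' := integrable_quadForm hV' w
  calc 2 * μ.real Set.univ * ‖star v ⬝ᵥ w‖
      = ∫ _, 2 * ‖star v ⬝ᵥ w‖ ∂μ := by rw [integral_const, smul_eq_mul]; ring
    _ ≤ ∫ x, quadForm (V x) v + quadForm (V x)⁻¹ w ∂μ :=
        integral_mono_ae (integrable_const _) (hquad.add hquad')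
          (hp.mono fun x hx => two_norm_dotProduct_le hx v w)
    _ = _ := by
        rw [integral_add hquad hquad', quadForm_matrixIntegral hV, quadForm_matrixIntegral hV']

end Integral

end MatrixCarleson

/-! ### Dyadic averages -/

namespace DyadicInterval

theorem volume_toSet (Q : DyadicInterval) : volume Q.toSet = ENNReal.ofReal (1 / 2 ^ Q.level) := by
  rw [toSet, Real.volume_Ico, ← sub_div, add_sub_cancel_left]

theorem volume_ne_zero (Q : DyadicInterval) : volume Q.toSet ≠ 0 := by
  rw [volume_toSet]
  exact (ENNReal.ofReal_pos.2 (by positivity)).ne'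

theorem volume_ne_top (Q : DyadicInterval) : volume Q.toSet ≠ ∞ := by
  rw [volume_toSet]
  exact ENNReal.ofReal_ne_top

instance (Q : DyadicInterval) : NeZero (volume.restrict Q.toSet) :=
  ⟨Measure.restrict_eq_zero.not.2 Q.volume_ne_zero⟩

instance (Q : DyadicInterval) : IsFiniteMeasure (volume.restrict Q.toSet) :=
  isFiniteMeasure_restrict.2 Q.volume_ne_top

theorem restrict_le_unitVolume (Q : DyadicInterval) : volume.restrict Q.toSet ≤ unitVolume :=
  Measure.restrict_mono ((toSet_subset_root Q).trans (toSet_root ▸ Set.Ico_subset_Icc_self)) le_rfl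

theorem restrict_root_eq_unitVolume : volume.restrict root.toSet = unitVolume := by
  rw [toSet_root, unitVolume, Measure.restrict_congr_set Ico_ae_eq_Icc]

theorem isAdditive_setIntegral {E : Type*} [NormedAddCommGroup E] [NormedSpace ℝ E] {f : ℝ → E}
    (hf : Integrable f unitVolume) : IsAdditive fun Q => ∫ x in Q.toSet, f x := fun Q => by
  dsimp only
  rw [← Q.left_union_right]
  exact setIntegral_union Q.disjoint_left_right measurableSet_Ico
    (hf.mono_measure (restrict_le_unitVolume _)) (hf.mono_measure (restrict_le_unitVolume _))

theorem isAdditive_volume : IsAdditive fun Q => volume.real Q.toSet := fun Q => by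
  dsimp only
  rw [← Q.left_union_right]
  exact measureReal_union Q.disjoint_left_right measurableSet_Ico Q.left.volume_ne_top
    Q.right.volume_ne_top

end DyadicInterval

open DyadicInterval in
theorem IsCarlesonSequence.sum_below_le {α : DyadicInterval → ℝ≥0} {A : ℝ≥0}
    (h : IsCarlesonSequence α A) (N : ℕ) (Q : DyadicInterval) :
    ∑ P ∈ below N Q, (α P : ℝ) ≤ A * volume.real Q.toSet := by
  have htsum : ∑' P : {P : DyadicInterval // P.toSet ⊆ Q.toSet}, (α P : ℝ≥0∞) ≤
      A * volume Q.toSet := by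
    have hQ := h Q
    rwa [mul_comm, ← div_eq_mul_inv, ENNReal.div_le_iff Q.volume_ne_zero Q.volume_ne_top] at hQ
  have hsum : ∑ P ∈ below N Q, (α P : ℝ≥0∞) ≤
      ∑' P : {P : DyadicInterval // P.toSet ⊆ Q.toSet}, (α P : ℝ≥0∞) := by
    rw [← Finset.tsum_subtype]
    exact ENNReal.tsum_mono_subtype (fun P => (α P : ℝ≥0∞)) fun P hP => (mem_below.1 hP).1
  have hreal := ENNReal.toReal_mono (ENNReal.mul_ne_top ENNReal.coe_ne_top Q.volume_ne_top)
    (hsum.trans htsum)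
  rwa [ENNReal.toReal_sum fun P _ => ENNReal.coe_ne_top, ENNReal.toReal_mul] at hreal

namespace MatrixCarleson

open Matrix DyadicInterval

theorem eLpNorm_two_eq_sqrt_integral {X E : Type*} [MeasurableSpace X] {μ : Measure X}
    [NormedAddCommGroup E] {f : X → E} (hf : MemLp f 2 μ) :
    eLpNorm f 2 μ = ENNReal.ofReal √(∫ x, ‖f x‖ ^ 2 ∂μ) := by
  rw [hf.eLpNorm_eq_integral_rpow_norm two_ne_zero ENNReal.ofNat_ne_top, Real.sqrt_eq_rpow]
  norm_num

section DyadicAverage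

variable {d : ℕ} {V : ℝ → Matrix (Fin d) (Fin d) ℂ} {f : ℝ → EuclideanSpace ℂ (Fin d)}

theorem isWeightedFamily_integral (hV : ∀ i j, Integrable (fun x => V x i j) unitVolume)
    (hp : ∀ᵐ x ∂unitVolume, (V x).PosDef) (hf : MemLp f 2 unitVolume) :
    IsWeightedFamily (fun Q => matrixIntegral (volume.restrict Q.toSet) V)
      (fun Q => sqrtIntegral (volume.restrict Q.toSet) V f)
      fun Q => ∫ x in Q.toSet, ‖f x‖ ^ 2 where
  posDef Q := posDef_matrixIntegral (fun i j => (hV i j).mono_measure Q.restrict_le_unitVolume)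
    (ae_mono Q.restrict_le_unitVolume hp)
  additive_weight Q := by
    ext i j
    exact isAdditive_setIntegral (hV i j) Q
  additive_vector Q := by
    ext i
    exact isAdditive_setIntegral
      (integrable_sqrt_mulVec hV (hp.mono fun x hx => hx.posSemidef.nonneg) hf i) Q
  additive_energy := isAdditive_setIntegral (hf.integrable_norm_pow two_ne_zero)
  quadForm_inv_le Q := quadForm_inv_sqrtIntegral_le
    (fun i j => (hV i j).mono_measure Q.restrict_le_unitVolume)
    (ae_mono Q.restrict_le_unitVolume hp) (hf.mono_measure Q.restrict_le_unitVolume)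

theorem matrixIntegral_restrict_mem_pairingCone
    (hV : ∀ i j, Integrable (fun x => V x i j) unitVolume)
    (hV' : ∀ i j, Integrable (fun x => (V x)⁻¹ i j) unitVolume)
    (hp : ∀ᵐ x ∂unitVolume, (V x).PosDef) (Q : DyadicInterval) :
    (matrixIntegral (volume.restrict Q.toSet) V,
      matrixIntegral (volume.restrict Q.toSet) fun x => (V x)⁻¹, volume.real Q.toSet) ∈
      pairingCone ℂ (Fin d) := by
  rw [← measureReal_restrict_apply_univ]
  exact matrixIntegral_mem_pairingCone
    (fun i j => (hV i j).mono_measure Q.restrict_le_unitVolume)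
    (fun i j => (hV' i j).mono_measure Q.restrict_le_unitVolume)
    (ae_mono Q.restrict_le_unitVolume hp)

theorem matrixAverage_eq_smul (V : ℝ → Matrix (Fin d) (Fin d) ℂ) (Q : DyadicInterval) :
    matrixAverage V Q =
      (volume.real Q.toSet : ℂ)⁻¹ • matrixIntegral (volume.restrict Q.toSet) V := by
  ext i j
  simp only [matrixAverage, matrixIntegral, of_apply, Matrix.smul_apply]
  rw [setAverage_eq, Complex.real_smul, smul_eq_mul, Complex.ofReal_inv]

theorem vectorAverage_sqrt_eq_smul (hV : ∀ i j, Integrable (fun x => V x i j) unitVolume)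
    (hp : ∀ᵐ x ∂unitVolume, 0 ≤ V x) (hf : MemLp f 2 unitVolume) (Q : DyadicInterval) :
    (vectorAverage (fun x => toEuclideanLin (CFC.sqrt (V x)) (f x)) Q).ofLp =
      (volume.real Q.toSet : ℂ)⁻¹ • sqrtIntegral (volume.restrict Q.toSet) V f := by
  have hint : IntegrableOn (fun x => toEuclideanLin (CFC.sqrt (V x)) (f x)) Q.toSet :=
    (PiLp.continuousLinearEquiv 2 ℂ fun _ : Fin d => ℂ).integrable_comp_iff.1 <|
      Integrable.of_eval fun i =>
        (integrable_sqrt_mulVec hV hp hf i).mono_measure Q.restrict_le_unitVolume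
  ext i
  rw [vectorAverage, setAverage_eq, PiLp.smul_apply, Pi.smul_apply, Complex.real_smul,
    smul_eq_mul, Complex.ofReal_inv]
  congr 1
  exact ((EuclideanSpace.proj (𝕜 := ℂ) i).integral_comp_comm hint).symm

theorem inv_smul_mulVec_smul {𝕜 n : Type*} [Field 𝕜] [Fintype n] [DecidableEq n]
    {X : Matrix n n 𝕜} (hX : IsUnit X.det) {c : 𝕜} (hc : c ≠ 0) (v : n → 𝕜) :
    (c • X)⁻¹ *ᵥ (c • v) = X⁻¹ *ᵥ v := by
  have := invertibleOfNonzero hc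
  rw [inv_smul _ _ hX, invOf_eq_inv, smul_mulVec, mulVec_smul, inv_smul_smul₀ hc]

theorem weightedAverage_eq (hV : ∀ i j, Integrable (fun x => V x i j) unitVolume)
    (hp : ∀ᵐ x ∂unitVolume, (V x).PosDef) (hf : MemLp f 2 unitVolume) (Q : DyadicInterval) :
    (weightedAverage V f Q).ofLp = (matrixIntegral (volume.restrict Q.toSet) V)⁻¹ *ᵥ
      sqrtIntegral (volume.restrict Q.toSet) V f := by
  have hvol : (volume.real Q.toSet : ℂ)⁻¹ ≠ 0 := inv_ne_zero <| Complex.ofReal_ne_zero.2 <|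
    (measureReal_ne_zero_iff Q.volume_ne_top).2 Q.volume_ne_zero
  rw [weightedAverage, toLpLin_apply, matrixAverage_eq_smul,
    vectorAverage_sqrt_eq_smul hV (hp.mono fun x hx => hx.posSemidef.nonneg) hf,
    inv_smul_mulVec_smul ((isWeightedFamily_integral hV hp hf).posDef Q).det_pos.ne'.isUnit hvol]

theorem exists_sum_inner_weightedAverage_le (d : ℕ) (A : ℝ≥0) :
    ∃ C : ℝ, 0 ≤ C ∧ ∀ α, IsCarlesonSequence α A → ∀ W : ℝ → Matrix (Fin d) (Fin d) ℂ,
      (∀ i j, Integrable (fun x => W x i j) unitVolume) →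
      (∀ i j, Integrable (fun x => (W x)⁻¹ i j) unitVolume) → (∀ᵐ x ∂unitVolume, (W x).PosDef) →
      ∀ f g, MemLp f 2 unitVolume → MemLp g 2 unitVolume → ∀ N,
        ∑ Q ∈ below N root, (α Q : ℝ) *
            ‖inner ℂ (weightedAverage W f Q) (weightedAverage (fun x => (W x)⁻¹) g Q)‖ ≤
          C * (√(∫ x, ‖f x‖ ^ 2 ∂unitVolume) * √(∫ x, ‖g x‖ ^ 2 ∂unitVolume)) := by
  obtain ⟨C, hC, hCle⟩ := exists_sum_pairing_le ℂ (Fin d) A.coe_nonneg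
  refine ⟨C, hC, fun α hα W hW hWinv hp f g hf hg N => ?_⟩
  have hpinv : ∀ᵐ x ∂unitVolume, ((W x)⁻¹).PosDef := hp.mono fun x hx => hx.inv
  simp only [EuclideanSpace.inner_eq_star_dotProduct, dotProduct_comm _ (star _),
    weightedAverage_eq hW hp hf, weightedAverage_eq hWinv hpinv hg, ← restrict_root_eq_unitVolume]
  exact hCle _ _ _ _ _ _ _ (isWeightedFamily_integral hW hp hf)
    (isWeightedFamily_integral hWinv hpinv hg) isAdditive_volume
    (matrixIntegral_restrict_mem_pairingCone hW hWinv hp) (fun Q => α Q) N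
    (fun Q => (α Q).coe_nonneg) (hα.sum_below_le N) root

end DyadicAverage

end MatrixCarleson

theorem theorem2p1 (d : ℕ) (A : ℝ≥0) :
    ∃ B : ℝ≥0, ∀ α : DyadicInterval → ℝ≥0, IsCarlesonSequence α A →
      ∀ W : ℝ → Matrix (Fin d) (Fin d) ℂ, IsMatrixWeight W →
        (∀ᵐ x ∂unitVolume, IsUnit (W x)) → (∀ i j, Integrable (fun x => (W x)⁻¹ i j) unitVolume) →
        ∀ f g : ℝ → EuclideanSpace ℂ (Fin d), MemLp f 2 unitVolume → MemLp g 2 unitVolume →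
          ∑' Q : DyadicInterval, (α Q : ℝ≥0∞) *
              ‖inner ℂ (weightedAverage W f Q) (weightedAverage (fun x => (W x)⁻¹) g Q)‖ₑ ≤
            B * eLpNorm f 2 unitVolume * eLpNorm g 2 unitVolume := by
  obtain ⟨C, hC, hCle⟩ := MatrixCarleson.exists_sum_inner_weightedAverage_le d A
  lift C to ℝ≥0 using hC
  refine ⟨C, fun α hα W hW hunit hWinv f g hf hg => ?_⟩
  have hp : ∀ᵐ x ∂unitVolume, (W x).PosDef := by
    filter_upwards [hW.posSemidef, hunit] with x hx hu
    exact hx.posDef_iff_isUnit.2 hu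
  refine DyadicInterval.tsum_le_of_sum_below_root_le fun N => ?_
  have hN := ENNReal.ofReal_le_ofReal (hCle α hα W hW.integrable hWinv hp f g hf hg N)
  rw [ENNReal.ofReal_sum_of_nonneg fun Q _ => by positivity] at hN
  simpa only [MatrixCarleson.eLpNorm_two_eq_sqrt_integral hf,
    MatrixCarleson.eLpNorm_two_eq_sqrt_integral hg, ENNReal.ofReal_mul NNReal.zero_le_coe,
    ENNReal.ofReal_mul (Real.sqrt_nonneg _), ENNReal.ofReal_coe_nnreal, ofReal_norm,
    mul_assoc] using hN
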